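/- Let $R$ be a commutative Artinian ring and let $\Lambda$ be an Artinian $R$-algebra, i.e. an $R$-algebra that is finitely generated as an $R$-module. Let $\operatorname{mod}\Lambda$ be the category of finitely generated left $\Lambda$-modules, and let $\mathbb{D}\Lambda^{op}$ be the left $\Lambda$-module $\operatorname{Hom}_R(\Lambda, I(R/J(R)))$, where $\Lambda$ is regarded as a right module over itself and $I(R/J(R))$ is the injective envelope of $R/J(R)$, with $J(R)$ the Jacobson radical. For $M\in\operatorname{mod}\Lambda$, the reduced grade is $\operatorname{r.grade} M=\inf\{n\ge 1\mid \operatorname{Ext}^n_\Lambda(M,\Lambda)\ne 0\}$ (with $\inf\emptyset=\infty$), and $\operatorname{add}_\Lambda M$ is the full subcategory of all modules isomorphic to direct summands of finite direct sums of copies of $M$. The algebra $\Lambda$ is almost hereditary if $\operatorname{gl.dim}\Lambda\le 2$ and every indecomposable $X\in\operatorname{mod}\Lambda$ satisfies $\operatorname{id}_\Lambda X\le 1$ or $\operatorname{pd}_\Lambda X\le 1$. A maximal $1$-orthogonal subcategory of $\operatorname{mod}\Lambda$ is a functorially finite full subcategory $\mathscr{C}$ of $\operatorname{mod}\Lambda$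 (every $X \in \operatorname{mod}\Lambda$ has a left and a right $\mathscr{C}$-approximation) such that $$\mathscr{C}=\{X\in\operatorname{mod}\Lambda\mid \operatorname{Ext}^1_\Lambda(X,C)=0\ \forall C\in\mathscr{C}\}=\{X\in\operatorname{mod}\Lambda\mid \operatorname{Ext}^1_\Lambda(C,X)=0\ \forall C\in\mathscr{C}\}.$$ Theorem 3.15. Let $\Lambda$ be an almost hereditary Artinian algebra with $\operatorname{gl.dim}\Lambda=2$. Then the following statements are equivalent. (1) $\Lambda$ admits a maximal $1$-orthogonal subcategory of $\operatorname{mod}\Lambda$. (2) (i) $\operatorname{r.grade}\mathbb{D}\Lambda^{op}=2$, and (ii) every non-projective indecomposable $M\in\operatorname{mod}\Lambda$ with $\operatorname{r.grade} M=2$ is injective. (3) For every non-projective indecomposable $M\in\operatorname{mod}\Lambda$, $M$ is injective if and only if $\operatorname{r.grade} M=2$. Moreover, if $\mathscr{C}$ is any maximal $1$-orthogonal subcategory of $\operatorname{mod}\Lambda$, then $\mathscr{C}=\operatorname{add}_\Lambda(\Lambda\oplus\mathbb{D}\Lambda^{op})$. -/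

import Mathlib

open CategoryTheory CategoryTheory.Limits CategoryTheory.Abelian

universe u

noncomputable section

/-! ### Injective envelopes -/

/-- `ι : M → E` is an injective envelope of `M`: a monomorphism into an injective module
such that every submodule of `E` that meets the image of `M` trivially is zero. -/
structure IsInjectiveEnvelope {R : Type u} [Ring R] {M E : Type u} [AddCommGroup M] [Module R M]
    [AddCommGroup E] [Module R E] (ι : M →ₗ[R] E) : Prop where
  injective : Function.Injective ι
  module_injective : Module.Injective R E
  essential : ∀ N : Submodule R E, N ⊓ LinearMap.range ι = ⊥ → N = ⊥

/-- Inside an injective module `Q`, every submodule `N` has an essential extension `E ≤ Q`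
that is a retract of `Q`. -/
theorem exists_essential_retract {R Q : Type u} [Ring R] [AddCommGroup Q] [Module R Q]
    [hQ : Module.Injective R Q] (N : Submodule R Q) :
    ∃ E : Submodule R Q, N ≤ E ∧
      (∀ x ∈ E, x ≠ 0 → ∃ r : R, r • x ≠ 0 ∧ r • x ∈ N) ∧
      ∃ p : Q →ₗ[R] E, ∀ e : E, p e = e := by
  obtain ⟨E, hNE, hE⟩ := zorn_le_nonempty₀
    {E : Submodule R Q | N ≤ E ∧ ∀ x ∈ E, x ≠ 0 → ∃ r : R, r • x ≠ 0 ∧ r • x ∈ N}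
    (by
      intro c hc hchain y hy
      refine ⟨sSup c, ⟨(hc hy).1.trans (le_sSup hy), ?_⟩, fun z hz => le_sSup hz⟩
      intro x hx hx0
      obtain ⟨z, hz, hxz⟩ := (Submodule.mem_sSup_of_directed ⟨y, hy⟩ hchain.directedOn).1 hx
      exact (hc hz).2 x hxz hx0) N
    ⟨le_rfl, fun x hx hx0 => ⟨1, by simpa using hx0, by simpa using hx⟩⟩
  obtain ⟨K, -, hK⟩ := zorn_le_nonempty₀ {K : Submodule R Q | ∀ x ∈ K, x ∈ E → x = 0}
    (by
      intro c hc hchain y hy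
      refine ⟨sSup c, ?_, fun z hz => le_sSup hz⟩
      intro x hx hxE
      obtain ⟨z, hz, hxz⟩ := (Submodule.mem_sSup_of_directed ⟨y, hy⟩ hchain.directedOn).1 hx
      exact hc hz x hxz hxE) ⊥ (by intro x hx _; simpa using hx)
  obtain ⟨h, hh⟩ := hQ.out (K.mkQ ∘ₗ E.subtype) (by
    rw [← LinearMap.ker_eq_bot, LinearMap.ker_eq_bot']
    rintro ⟨m, hm⟩ h0
    have : m ∈ K := by simpa using h0
    exact Subtype.ext (hK.prop m this hm)) E.subtype
  have hh' : ∀ e ∈ E, h (K.mkQ e) = e := fun e he => hh ⟨e, he⟩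
  have hker : ∀ q, h (K.mkQ q) = 0 → q ∈ K := by
    have hle : LinearMap.ker (h ∘ₗ K.mkQ) ≤ K := by
      refine hK.le_of_ge ?_ ?_
      · intro x hx hxE
        rw [← hh' x hxE]
        exact hx
      · intro x hx
        have : K.mkQ x = 0 := by simpa using hx
        simp only [LinearMap.mem_ker, LinearMap.comp_apply, this, map_zero]
    exact fun q hq => hle hq
  have hrange : LinearMap.range (h ∘ₗ K.mkQ) ≤ E := by
    refine hE.le_of_ge ⟨?_, ?_⟩ ?_
    · intro x hx
      exact ⟨x, hh' x (hNE hx)⟩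
    · rintro _ ⟨q, rfl⟩ hx0
      have hqK : q ∉ K := by
        intro hq
        apply hx0
        have : K.mkQ q = 0 := by simpa using hq
        simp only [LinearMap.comp_apply, this, map_zero]
      have hnot : ¬ ∀ x ∈ K ⊔ Submodule.span R {q}, x ∈ E → x = 0 := by
        intro hbad
        have := hK.le_of_ge hbad le_sup_left
        exact hqK (this (Submodule.mem_sup_right (Submodule.mem_span_singleton_self q)))
      push Not at hnot
      obtain ⟨x, hx, hxE, hxne⟩ := hnot
      obtain ⟨k, hk, y, hy, rfl⟩ := Submodule.mem_sup.1 hx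
      obtain ⟨r, rfl⟩ := Submodule.mem_span_singleton.1 hy
      have hk0 : K.mkQ k = 0 := by simpa using hk
      have e1 : r • (h ∘ₗ K.mkQ) q = k + r • q := by
        have := hh' _ hxE
        rw [map_add, hk0, zero_add] at this
        rw [← map_smul]
        exact this
      obtain ⟨s, hs0, hsN⟩ := hE.prop.2 _ hxE hxne
      exact ⟨s * r, by rwa [mul_smul, e1], by rwa [mul_smul, e1]⟩
    · intro x hx
      exact ⟨x, hh' x hx⟩
  refine ⟨E, hE.prop.1, hE.prop.2,
    LinearMap.codRestrict E (h ∘ₗ K.mkQ) (fun q => hrange ⟨q, rfl⟩), ?_⟩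
  rintro ⟨e, he⟩
  exact Subtype.ext (hh' e he)

theorem exists_isInjectiveEnvelope (R : Type u) [Ring R] (M : Type u) [AddCommGroup M]
    [Module R M] :
    ∃ (E : ModuleCat.{u} R) (ι : M →ₗ[R] E), IsInjectiveEnvelope ι := by
  let X : ModuleCat.{u} R := ModuleCat.of R M
  let Q : ModuleCat.{u} R := Injective.under X
  let j : M →ₗ[R] Q := (Injective.ι X).hom
  have hj : Function.Injective j := (ModuleCat.mono_iff_injective (Injective.ι X)).1 inferInstance
  have hQ' : Injective (ModuleCat.of R Q) := inferInstanceAs (Injective (Injective.under X))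
  have hQ : Module.Injective R Q := Module.injective_module_of_injective_object R Q
  obtain ⟨E, hNE, hess, p, hp⟩ := exists_essential_retract (LinearMap.range j)
  refine ⟨ModuleCat.of R E, LinearMap.codRestrict E j (fun m => hNE ⟨m, rfl⟩), ?_, ?_, ?_⟩
  · intro a b hab
    exact hj (congrArg Subtype.val hab)
  · refine ⟨fun A B _ _ _ _ f hf g => ?_⟩
    obtain ⟨k, hk⟩ := hQ.out f hf (E.subtype ∘ₗ g)
    refine ⟨p ∘ₗ k, fun x => ?_⟩
    rw [LinearMap.comp_apply, hk]
    exact hp (g x)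
  · intro L hL
    rw [Submodule.eq_bot_iff]
    intro x hx
    by_contra hx0
    obtain ⟨r, hr0, m, hm⟩ := hess x.1 x.2 (fun h => hx0 (Subtype.ext h))
    have : r • x ∈ L ⊓ LinearMap.range (LinearMap.codRestrict E j (fun m => hNE ⟨m, rfl⟩)) :=
      ⟨L.smul_mem r hx, m, Subtype.ext hm⟩
    rw [hL, Submodule.mem_bot] at this
    exact hr0 (congrArg Subtype.val this)

/-- The injective envelope `I(M)` of an `R`-module `M`. -/
def injectiveEnvelope (R : Type u) [Ring R] (M : Type u) [AddCommGroup M] [Module R M] :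
    ModuleCat.{u} R :=
  (exists_isInjectiveEnvelope R M).choose

/-- The embedding of `M` into its injective envelope. -/
def injectiveEnvelopeMap (R : Type u) [Ring R] (M : Type u) [AddCommGroup M] [Module R M] :
    M →ₗ[R] injectiveEnvelope R M :=
  (exists_isInjectiveEnvelope R M).choose_spec.choose

theorem injectiveEnvelopeMap_spec (R : Type u) [Ring R] (M : Type u) [AddCommGroup M]
    [Module R M] : IsInjectiveEnvelope (injectiveEnvelopeMap R M) :=
  (exists_isInjectiveEnvelope R M).choose_spec.choose_spec

/-! ### The dual of the regular right module -/

section Dual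

variable (R Λ : Type u) [CommRing R] [Ring Λ] [Algebra R Λ]

/-- `𝔻(Λᵒᵖ) = Hom_R(Λ, I(R / J(R)))`, where `Λ` is regarded as a right module over itself. -/
def DualOp : Type u := Λ →ₗ[R] injectiveEnvelope R (R ⧸ Ring.jacobson R)

instance : AddCommGroup (DualOp R Λ) :=
  inferInstanceAs (AddCommGroup (Λ →ₗ[R] injectiveEnvelope R (R ⧸ Ring.jacobson R)))

/-- The left `Λ`-action on `Hom_R(Λ, I(R / J(R)))` is `(a • f) x = f (x * a)`. -/
instance : Module Λ (DualOp R Λ) where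
  smul a f := LinearMap.comp (show Λ →ₗ[R] injectiveEnvelope R (R ⧸ Ring.jacobson R) from f)
    (LinearMap.mulRight R a)
  one_smul f := LinearMap.ext fun x => congrArg (fun y => f.toFun y) (mul_one x)
  mul_smul a b f := LinearMap.ext fun x => congrArg (fun y => f.toFun y) (mul_assoc x a b).symm
  smul_zero _ := LinearMap.ext fun _ => rfl
  smul_add _ _ _ := LinearMap.ext fun _ => rfl
  add_smul a b f := LinearMap.ext fun x =>
    (congrArg (fun y => f.toFun y) (mul_add x a b)).trans (map_add f.toAddHom _ _)
  zero_smul f := LinearMap.ext fun x =>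
    (congrArg (fun y => f.toFun y) (mul_zero x)).trans (LinearMap.map_zero f)

end Dual

/-! ### Subcategories of `mod Λ` and homological invariants -/

section Modules

variable {Λ : Type u} [Ring Λ]

/-- `add M`: the modules isomorphic to a direct summand of a finite direct sum of copies
of `M`. -/
def addClosure (M : ModuleCat.{u} Λ) : ObjectProperty (ModuleCat.{u} Λ) := fun X =>
  ∃ (n : ℕ) (Y : ModuleCat.{u} Λ), Nonempty ((X × Y) ≃ₗ[Λ] (Fin n → M))

/-- `^{⊥ₙ}𝒞` -/
def leftOrthogonal (n : ℕ) (C : ObjectProperty (ModuleCat.{u} Λ)) :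
    ObjectProperty (ModuleCat.{u} Λ) := fun X =>
  ModuleCat.isFG Λ X ∧ ∀ Y, C Y → ∀ i : ℕ, 1 ≤ i → i ≤ n → Subsingleton (Ext X Y i)

/-- `𝒞^{⊥ₙ}` -/
def rightOrthogonal (n : ℕ) (C : ObjectProperty (ModuleCat.{u} Λ)) :
    ObjectProperty (ModuleCat.{u} Λ) := fun X =>
  ModuleCat.isFG Λ X ∧ ∀ Y, C Y → ∀ i : ℕ, 1 ≤ i → i ≤ n → Subsingleton (Ext Y X i)

/-- `f : X → Y` is a left `𝒞`-approximation of `X`. -/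
def IsLeftApproximation (C : ObjectProperty (ModuleCat.{u} Λ)) {X Y : ModuleCat.{u} Λ}
    (f : X ⟶ Y) : Prop :=
  C Y ∧ ∀ (Z : ModuleCat.{u} Λ), C Z → ∀ g : X ⟶ Z, ∃ h : Y ⟶ Z, f ≫ h = g

/-- `f : Y → X` is a right `𝒞`-approximation of `X`. -/
def IsRightApproximation (C : ObjectProperty (ModuleCat.{u} Λ)) {X Y : ModuleCat.{u} Λ}
    (f : Y ⟶ X) : Prop :=
  C Y ∧ ∀ (Z : ModuleCat.{u} Λ), C Z → ∀ g : Z ⟶ X, ∃ h : Z ⟶ Y, h ≫ f = g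

/-- `𝒞` is functorially finite in `𝒟`. -/
def IsFunctoriallyFinite (C D : ObjectProperty (ModuleCat.{u} Λ)) : Prop :=
  (∀ X, D X → ∃ (Y : ModuleCat.{u} Λ) (f : X ⟶ Y), IsLeftApproximation C f) ∧
  (∀ X, D X → ∃ (Y : ModuleCat.{u} Λ) (f : Y ⟶ X), IsRightApproximation C f)

/-- `𝒞` is a maximal `n`-orthogonal subcategory of `𝒟` (for full subcategories
`𝒞 ⊆ 𝒟 ⊆ mod Λ`). -/
structure IsMaximalOrthogonal (n : ℕ) (C D : ObjectProperty (ModuleCat.{u} Λ)) : Prop where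
  le : C ≤ D
  le_fg : D ≤ ModuleCat.isFG Λ
  functoriallyFinite : IsFunctoriallyFinite C D
  eq_left : C = leftOrthogonal n C ⊓ D
  eq_right : C = rightOrthogonal n C ⊓ D

/-- The reduced grade `inf {n ≥ 1 | Extⁿ(M, Λ) ≠ 0}`, equal to `∞` if there is no such `n`. -/
def reducedGrade (M : ModuleCat.{u} Λ) : ℕ∞ :=
  ⨅ n ∈ {n : ℕ | 1 ≤ n ∧ Nontrivial (Ext M (ModuleCat.of Λ Λ) n)}, (n : ℕ∞)

variable (Λ)

/-- The (left) global dimension. -/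
def globalDimension : WithBot ℕ∞ := ⨆ M : ModuleCat.{u} Λ, projectiveDimension M

/-- Almost hereditary algebras. -/
structure IsAlmostHereditary : Prop where
  globalDimension_le : globalDimension Λ ≤ 2
  dimension_le : ∀ X : ModuleCat.{u} Λ, ModuleCat.isFG Λ X → Indecomposable X →
    injectiveDimension X ≤ 1 ∨ projectiveDimension X ≤ 1

end Modules

end

/-! Write D for `DualOp R Λ`, an injective cogenerator that is finitely generated over Λ. A maximal
1-orthogonal C contains Λ and D, because Ext¹ out of projectives and into injectives vanishes. Let X
in C be indecomposable. If id X ≤ 1, embed X in I in add D; the cokernel is injective, so it lies in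
add D, and Ext¹(D, X) = 0 splits the sequence: X is injective. Dually, pd X ≤ 1 and Ext¹(X, Λ) = 0
make X projective. Induction on length then gives C = add(Λ ⊕ D)
(`IsMaximalOrthogonal.eq_addClosure`).

In global dimension at most 2, a finitely generated non-projective M has reduced grade 2 as soon as
Ext¹(M, Λ) = 0 (`reducedGrade_eq_two`), so every grade condition is a statement about Ext¹ into Λ.
Moreover D is not projective, since otherwise the global dimension would be 0. This turns (1) into
(2); (3) follows because every finitely generated injective lies in add D.

For (3) ⇒ (1), the condition says that add(Λ ⊕ D) is self-orthogonal and contains every finitely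
generated X with Ext¹(X, Λ) = 0. For the right-hand equality, a left approximation X → Y is mono,
and its cokernel K has Ext¹(K, Λ) = 0. Hence K lies in the subcategory, and Ext¹(K, X) = 0 makes X a
summand of Y (`isMaximalOrthogonal_addClosure`). -/

/-! ### Summands of finite sums, and Ext -/

section AddRetract

universe w v

variable {C : Type u} [Category.{v} C] [Abelian C]

/-- `X` is a direct summand of a finite direct sum of copies of `T`, expressed by a decomposition
of the identity of `X` as a sum of endomorphisms factoring through `T`. -/
def IsAddRetract (T X : C) : Prop :=
  ∃ (n : ℕ) (p : Fin n → (X ⟶ T)) (q : Fin n → (T ⟶ X)), ∑ i, p i ≫ q i = 𝟙 X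

namespace IsAddRetract

variable {T X Y : C}

theorem of_fintype {ι : Type*} [Fintype ι] (p : ι → (X ⟶ T)) (q : ι → (T ⟶ X))
    (h : ∑ i, p i ≫ q i = 𝟙 X) : IsAddRetract T X := by
  refine ⟨Fintype.card ι, fun i => p ((Fintype.equivFin ι).symm i),
    fun i => q ((Fintype.equivFin ι).symm i), ?_⟩
  rw [← h]
  exact (Fintype.equivFin ι).symm.sum_comp fun i => p i ≫ q i

theorem of_retract (h : Retract X T) : IsAddRetract T X :=
  ⟨1, fun _ => h.i, fun _ => h.r, by simp⟩

theorem refl (T : C) : IsAddRetract T T := of_retract (Retract.refl T)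

theorem trans {Z : C} (h₁ : IsAddRetract T X) (h₂ : IsAddRetract X Z) : IsAddRetract T Z := by
  obtain ⟨n, p, q, h⟩ := h₁
  obtain ⟨m, p', q', h'⟩ := h₂
  refine of_fintype (fun k : Fin m × Fin n => p' k.1 ≫ p k.2) (fun k => q k.2 ≫ q' k.1) ?_
  rw [Fintype.sum_prod_type, ← h']
  refine Finset.sum_congr rfl fun i _ => ?_
  calc ∑ j, (p' i ≫ p j) ≫ q j ≫ q' i = p' i ≫ (∑ j, p j ≫ q j) ≫ q' i := by
        simp [Preadditive.comp_sum, Preadditive.sum_comp]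
    _ = p' i ≫ q' i := by rw [h, Category.id_comp]

theorem of_isZero (h : IsZero X) : IsAddRetract T X :=
  ⟨0, Fin.elim0, Fin.elim0, h.eq_of_src _ _⟩

theorem biprod (h₁ : IsAddRetract T X) (h₂ : IsAddRetract T Y) : IsAddRetract T (X ⊞ Y) := by
  obtain ⟨n, p, q, h⟩ := h₁
  obtain ⟨m, p', q', h'⟩ := h₂
  refine of_fintype (Sum.elim (fun i => biprod.fst ≫ p i) fun i => biprod.snd ≫ p' i)
    (Sum.elim (fun i => q i ≫ biprod.inl) fun i => q' i ≫ biprod.inr) ?_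
  have e₁ : ∑ i, ((biprod.fst : X ⊞ Y ⟶ X) ≫ p i) ≫ q i ≫ (biprod.inl : X ⟶ X ⊞ Y) =
      biprod.fst ≫ (∑ i, p i ≫ q i) ≫ biprod.inl := by
    simp [Preadditive.comp_sum, Preadditive.sum_comp]
  have e₂ : ∑ i, ((biprod.snd : X ⊞ Y ⟶ Y) ≫ p' i) ≫ q' i ≫ (biprod.inr : Y ⟶ X ⊞ Y) =
      biprod.snd ≫ (∑ i, p' i ≫ q' i) ≫ biprod.inr := by
    simp [Preadditive.comp_sum, Preadditive.sum_comp]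
  rw [Fintype.sum_sum_type]
  simp only [Sum.elim_inl, Sum.elim_inr]
  rw [e₁, e₂, h, h', Category.id_comp, Category.id_comp, biprod.total]

variable [HasExt.{w} C]

/-- Composing a class with the decomposed identity of X writes it as a sum of classes that pass
through Ext Z T n. -/
theorem subsingleton_ext_right (h : IsAddRetract T X) {Z : C} {n : ℕ}
    (hT : Subsingleton (Ext Z T n)) : Subsingleton (Ext Z X n) := by
  obtain ⟨m, p, q, h⟩ := h
  refine subsingleton_of_forall_eq 0 fun α => ?_
  rw [← Ext.comp_mk₀_id α, ← h, Ext.mk₀_sum, Ext.comp_sum]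
  refine Finset.sum_eq_zero fun i _ => ?_
  rw [← Ext.mk₀_comp_mk₀, ← Ext.comp_assoc_of_third_deg_zero,
    Subsingleton.elim (α.comp (Ext.mk₀ (p i)) _) 0, Ext.zero_comp]

theorem subsingleton_ext_left (h : IsAddRetract T X) {Z : C} {n : ℕ}
    (hT : Subsingleton (Ext T Z n)) : Subsingleton (Ext X Z n) := by
  obtain ⟨m, p, q, h⟩ := h
  refine subsingleton_of_forall_eq 0 fun α => ?_
  rw [← Ext.mk₀_id_comp α, ← h, Ext.mk₀_sum, Ext.sum_comp]
  refine Finset.sum_eq_zero fun i _ => ?_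
  rw [← Ext.mk₀_comp_mk₀_assoc,
    Subsingleton.elim ((Ext.mk₀ (q i)).comp α _) 0, Ext.comp_zero]

end IsAddRetract

theorem IsAddRetract.injective {T X : C} (h : IsAddRetract T X) (hT : Injective T) :
    Injective X := by
  let := HasExt.standard C
  rw [injective_iff_subsingleton_ext_one] at hT ⊢
  exact fun Y => h.subsingleton_ext_right (hT (Y := Y))

theorem IsAddRetract.projective {T X : C} (h : IsAddRetract T X) (hT : Projective T) :
    Projective X := by
  let := HasExt.standard C
  rw [projective_iff_subsingleton_ext_one] at hT ⊢
  exact fun Y => h.subsingleton_ext_left (hT (Y := Y))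

variable [HasExt.{w} C]

/-- The obstruction to lifting the identity of `S.X₃` along `S.g` is a class in the vanishing Ext¹
group. -/
theorem CategoryTheory.ShortComplex.ShortExact.nonempty_splitting {S : ShortComplex C}
    (hS : S.ShortExact) (h : Subsingleton (Ext S.X₃ S.X₁ 1)) : Nonempty S.Splitting := by
  obtain ⟨x, hx⟩ := Ext.covariant_sequence_exact₃ S.X₃ hS (Ext.mk₀ (𝟙 S.X₃)) (n₁ := 1) rfl
    (Subsingleton.elim _ _)
  obtain ⟨s, rfl⟩ := (Ext.mk₀_bijective _ _).2 x
  rw [Ext.mk₀_comp_mk₀] at hx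
  exact ⟨ShortComplex.Splitting.ofExactOfSection S hS.exact s
    ((Ext.mk₀_bijective _ _).1 hx) hS.mono_f⟩

/-- The first term of a split short complex is a retract of the middle one. -/
def CategoryTheory.ShortComplex.Splitting.retractLeft {S : ShortComplex C} (s : S.Splitting) :
    Retract S.X₁ S.X₂ := ⟨S.f, s.r, s.f_r⟩

/-- The last term of a split short complex is a retract of the middle one. -/
def CategoryTheory.ShortComplex.Splitting.retractRight {S : ShortComplex C} (s : S.Splitting) :
    Retract S.X₃ S.X₂ := ⟨s.s, S.g, s.s_g⟩

end AddRetract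

/-! ### add M and finitely generated modules -/

section Modules

variable {Λ : Type u} [Ring Λ]

theorem isAddRetract_finPi (M : ModuleCat.{u} Λ) (n : ℕ) :
    IsAddRetract M (ModuleCat.of Λ (Fin n → M)) := by
  refine ⟨n, fun i => ModuleCat.ofHom (LinearMap.proj i),
    fun i => ModuleCat.ofHom (LinearMap.single Λ (fun _ => M) i), ?_⟩
  refine ModuleCat.hom_ext (LinearMap.ext fun x => ?_)
  simp only [ModuleCat.hom_sum, ModuleCat.hom_comp, ModuleCat.hom_ofHom, ModuleCat.hom_id]
  rw [LinearMap.sum_apply]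
  simp only [LinearMap.comp_apply, LinearMap.proj_apply, LinearMap.id_apply]
  exact Finset.univ_sum_single x

theorem addClosure_iff {M X : ModuleCat.{u} Λ} : addClosure M X ↔ IsAddRetract M X := by
  constructor
  · rintro ⟨n, Y, ⟨e⟩⟩
    refine (isAddRetract_finPi M n).trans (.of_retract
      ⟨ModuleCat.ofHom (e.toLinearMap ∘ₗ LinearMap.inl Λ X Y),
        ModuleCat.ofHom (LinearMap.fst Λ X Y ∘ₗ e.symm.toLinearMap), ?_⟩)
    ext x
    simp
  · rintro ⟨n, p, q, h⟩
    let f : X →ₗ[Λ] (Fin n → M) := LinearMap.pi fun i => (p i).hom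
    let g : (Fin n → M) →ₗ[Λ] X := ∑ i, (q i).hom ∘ₗ LinearMap.proj i
    have hgf : g ∘ₗ f = LinearMap.id := by
      have := congrArg ModuleCat.Hom.hom h
      rw [ModuleCat.hom_sum] at this
      ext x
      have := LinearMap.congr_fun this x
      simpa [f, g, LinearMap.sum_apply] using this
    -- The complement of X in Mⁿ is the kernel of the retraction `g`.
    exact ⟨n, ModuleCat.of Λ (LinearMap.ker g),
      ⟨(LinearEquiv.prodComm Λ _ _).trans (lequivProdOfRightSplitExact (f := f) (g := g)
        (j := (LinearMap.ker g).subtype) (Submodule.subtype_injective _)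
        (by simp) hgf)⟩⟩

theorem CategoryTheory.Epi.isFG {X Y : ModuleCat.{u} Λ} (f : X ⟶ Y) [Epi f]
    (h : ModuleCat.isFG Λ X) : ModuleCat.isFG Λ Y := by
  have : Module.Finite Λ X := h
  exact Module.Finite.of_surjective f.hom ((ModuleCat.epi_iff_surjective f).1 inferInstance)

theorem CategoryTheory.Mono.isFG [IsNoetherianRing Λ] {X Y : ModuleCat.{u} Λ} (f : X ⟶ Y) [Mono f]
    (h : ModuleCat.isFG Λ Y) : ModuleCat.isFG Λ X := by
  have : Module.Finite Λ Y := h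
  exact Module.Finite.of_injective f.hom ((ModuleCat.mono_iff_injective f).1 inferInstance)

theorem IsAddRetract.isFG {T X : ModuleCat.{u} Λ} (h : IsAddRetract T X)
    (hT : ModuleCat.isFG Λ T) : ModuleCat.isFG Λ X := by
  obtain ⟨n, Y, ⟨e⟩⟩ := addClosure_iff.2 h
  have : Module.Finite Λ T := hT
  let f : (Fin n → T) →ₗ[Λ] X := LinearMap.fst Λ X Y ∘ₗ e.symm.toLinearMap
  exact Module.Finite.of_surjective f fun x => ⟨e (x, 0), by simp [f]⟩

/-- Reduction of a statement about finitely generated modules to indecomposable ones. -/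
theorem isFG_induction_indecomposable [IsArtinianRing Λ] (P Q : ModuleCat.{u} Λ → Prop)
    (hQ : ∀ X Y, Retract X Y → Q Y → Q X) (hP0 : ∀ X, IsZero X → P X)
    (hPbiprod : ∀ X Y Z, (X ≅ Y ⊞ Z) → P Y → P Z → P X)
    (hPQ : ∀ X, ModuleCat.isFG Λ X → Indecomposable X → Q X → P X)
    (X : ModuleCat.{u} Λ) (hX : ModuleCat.isFG Λ X) (hQX : Q X) : P X := by
  -- Induction on length: over an Artinian ring a decomposition into two nonzero summands strictly
  -- lowers the (finite) lengths.
  have key : ∀ l : ℕ∞, ∀ X : ModuleCat.{u} Λ, ModuleCat.isFG Λ X → Module.length Λ X = l →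
      Q X → P X := by
    intro l
    induction l using WellFoundedLT.induction with
    | ind l ih =>
    intro X hX hl hQX
    by_cases h0 : IsZero X
    · exact hP0 X h0
    by_cases hi : Indecomposable X
    · exact hPQ X hX hi hQX
    simp only [Indecomposable, h0, not_false_eq_true, true_and, not_forall, not_or] at hi
    obtain ⟨Y, Z, e, hY, hZ⟩ := hi
    have rY : Retract Y X := ⟨biprod.inl ≫ e.inv, e.hom ≫ biprod.fst, by simp⟩
    have rZ : Retract Z X := ⟨biprod.inr ≫ e.inv, e.hom ≫ biprod.snd, by simp⟩
    have fY := (IsAddRetract.of_retract rY).isFG hX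
    have fZ := (IsAddRetract.of_retract rZ).isFG hX
    have : Module.Finite Λ Y := fY
    have : Module.Finite Λ Z := fZ
    have hadd : Module.length Λ X = Module.length Λ Y + Module.length Λ Z := by
      rw [(e ≪≫ ModuleCat.biprodIsoProd Y Z).toLinearEquiv.length_eq]
      exact Module.length_prod Λ Y Z
    have nY : Module.length Λ Y ≠ 0 := by
      rw [ne_eq, Module.length_eq_zero_iff]
      exact fun h => hY (ModuleCat.isZero_of_subsingleton Y)
    have nZ : Module.length Λ Z ≠ 0 := by
      rw [ne_eq, Module.length_eq_zero_iff]
      exact fun h => hZ (ModuleCat.isZero_of_subsingleton Z)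
    have tY : Module.length Λ Y ≠ ⊤ := Module.length_ne_top
    have tZ : Module.length Λ Z ≠ ⊤ := Module.length_ne_top
    rw [hl] at hadd
    refine hPbiprod X Y Z e (ih (Module.length Λ Y) ?_ Y fY rfl (hQ _ _ rY hQX))
      (ih (Module.length Λ Z) ?_ Z fZ rfl (hQ _ _ rZ hQX))
    · rw [hadd, add_comm]
      exact ENat.lt_add_left tY (pos_iff_ne_zero.2 nZ)
    · rw [hadd]
      exact ENat.lt_add_left tZ (pos_iff_ne_zero.2 nY)
  exact key _ X hX rfl hQX

end Modules

/-! ### The injective envelope of R/J(R): finiteness and cogeneration -/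

section InjectiveEnvelope

variable (R : Type u) [CommRing R]

local notation "E" => injectiveEnvelope R (R ⧸ Ring.jacobson R)

/-- By essentiality some nonzero multiple of y lies in the image; as p is maximal and kills y, that
multiple can be scaled back to y. -/
theorem mem_range_injectiveEnvelopeMap_of_maximal {p : Ideal R} (hp : p.IsMaximal) {y : E}
    (hy : ∀ r ∈ p, r • y = 0) :
    y ∈ LinearMap.range (injectiveEnvelopeMap R (R ⧸ Ring.jacobson R)) := by
  by_cases h0 : y = 0
  · rw [h0]
    exact zero_mem _
  have hs := (injectiveEnvelopeMap_spec R (R ⧸ Ring.jacobson R)).essential (R ∙ y)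
  have hne : (R ∙ y) ⊓ LinearMap.range (injectiveEnvelopeMap R (R ⧸ Ring.jacobson R)) ≠ ⊥ :=
    fun h => h0 (Submodule.span_singleton_eq_bot.1 (hs h))
  obtain ⟨z, ⟨hz₁, hz₂⟩, hz0⟩ := Submodule.exists_mem_ne_zero_of_ne_bot hne
  obtain ⟨r, rfl⟩ := Submodule.mem_span_singleton.1 hz₁
  have hr : r ∉ p := fun hr => hz0 (hy r hr)
  obtain ⟨s, m, hm, hsm⟩ := hp.exists_inv hr
  have : y = s • r • y := by
    rw [smul_smul, ← add_zero ((s * r) • y), ← hy m hm, ← add_smul, hsm, one_smul]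
  rw [this]
  exact Submodule.smul_mem _ _ hz₂

variable [IsArtinianRing R]

/-- Dévissage to M = R/p. There p is maximal, and evaluation at the generator embeds Hom(R/p, E)
into the p-torsion of E, which lies in the image of R/J(R). Extensions use left exactness of Hom(-,
E). -/
theorem finite_hom_injectiveEnvelope (M : Type u) [AddCommGroup M] [Module R M]
    [hM : Module.Finite R M] : Module.Finite R (M →ₗ[R] E) := by
  induction hM using IsNoetherianRing.induction_on_isQuotientEquivQuotientPrime R with
  | subsingleton N => infer_instance
  | quotient N p e =>
    have hp : p.1.IsMaximal := inferInstance
    let ev : (N →ₗ[R] E) →ₗ[R] E := LinearMap.applyₗ (e.symm 1)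
    have hmem : ∀ f, ev f ∈ LinearMap.range (injectiveEnvelopeMap R (R ⧸ Ring.jacobson R)) := by
      intro f
      refine mem_range_injectiveEnvelopeMap_of_maximal R hp fun r hr => ?_
      change r • f (e.symm 1) = 0
      have : r • (1 : R ⧸ p.1) = 0 := by
        rw [← map_one (Ideal.Quotient.mk p.1), ← Ideal.Quotient.mk_eq_mk, ← Submodule.Quotient.mk_smul]
        simpa [Ideal.Quotient.eq_zero_iff_mem] using hr
      rw [← map_smul, ← map_smul, this, map_zero, map_zero]
    refine Module.Finite.of_injective (LinearMap.codRestrict _ ev hmem) ?_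
    rw [LinearMap.injective_codRestrict_iff, injective_iff_map_eq_zero]
    intro f hf
    ext x
    obtain ⟨r, hr⟩ := Ideal.Quotient.mk_surjective (e x)
    have : x = r • e.symm 1 := by
      rw [← map_smul, LinearEquiv.eq_symm_apply, ← hr]
      rw [← map_one (Ideal.Quotient.mk p.1), ← Ideal.Quotient.mk_eq_mk, ← Ideal.Quotient.mk_eq_mk,
        ← Submodule.Quotient.mk_smul, smul_eq_mul, mul_one]
    have hf' : f (e.symm 1) = 0 := hf
    rw [this, map_smul, hf', smul_zero, LinearMap.zero_apply]
  | exact N₁ N₂ N₃ f g hf hg hfg h₁ h₃ =>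
    have : IsNoetherian R (N₂ →ₗ[R] E) := by
      refine isNoetherian_of_range_eq_ker (LinearMap.lcomp R E g) (LinearMap.lcomp R E f) ?_
      ext φ
      constructor
      · rintro ⟨ψ, rfl⟩
        ext x
        simp [hfg.apply_apply_eq_zero]
      · intro hφ
        have hφ' : LinearMap.range f ≤ LinearMap.ker φ := by
          rintro _ ⟨x, rfl⟩
          exact LinearMap.congr_fun hφ x
        have hle : LinearMap.ker g ≤ LinearMap.ker φ := by
          rwa [hfg.linearMap_ker_eq]
        refine ⟨(Submodule.liftQ _ φ hle) ∘ₗ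
          (g.quotKerEquivOfSurjective hg).symm.toLinearMap, ?_⟩
        ext x
        have : (g.quotKerEquivOfSurjective hg).symm (g x) = (LinearMap.ker g).mkQ x := by
          rw [LinearEquiv.symm_apply_eq]
          rfl
        simp [this]
    infer_instance

/-- The cyclic module Rx maps onto some R/p with p maximal. Since R/J(R) is semisimple, R/p embeds
in it and so in E; injectivity of E extends the composite to M. -/
theorem exists_hom_injectiveEnvelope_ne_zero {M : Type u} [AddCommGroup M] [Module R M]
    {x : M} (hx : x ≠ 0) : ∃ f : M →ₗ[R] E, f x ≠ 0 := by
  have hE := injectiveEnvelopeMap_spec R (R ⧸ Ring.jacobson R)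
  obtain ⟨p, hp, hxp⟩ := Ideal.exists_le_maximal (Ideal.torsionOf R M x) (by
    rw [Ne, Ideal.eq_top_iff_one, Ideal.mem_torsionOf_iff, one_smul]
    exact hx)
  have : IsSemisimpleModule R (R ⧸ Ring.jacobson R) := by
    rw [IsArtinian.isSemisimpleModule_iff_jacobson]
    exact Module.jacobson_quotient_jacobson R R
  have hJ : Ring.jacobson R ≤ p := by
    rw [Ring.jacobson_eq_sInf_isMaximal]
    exact sInf_le hp
  let π : (R ⧸ Ring.jacobson R) →ₗ[R] R ⧸ p := Submodule.factor hJ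
  have hπ : Function.Surjective π := Submodule.factor_surjective hJ
  obtain ⟨σ, hσ⟩ := IsSemisimpleModule.lifting_property π hπ LinearMap.id
  have hσ' : Function.Injective σ := by
    have : Function.Injective (π ∘ₗ σ) := by rw [hσ]; exact Function.injective_id
    exact Function.Injective.of_comp this
  let t : (R ∙ x) →ₗ[R] R ⧸ p :=
    Submodule.factor hxp ∘ₗ (Ideal.quotTorsionOfEquivSpanSingleton R M x).symm.toLinearMap
  have ht : t ⟨x, Submodule.mem_span_singleton_self x⟩ = Ideal.Quotient.mk p 1 := by
    have : (Ideal.quotTorsionOfEquivSpanSingleton R M x).symm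
        ⟨x, Submodule.mem_span_singleton_self x⟩ = Submodule.Quotient.mk 1 := by
      rw [LinearEquiv.symm_apply_eq, Ideal.quotTorsionOfEquivSpanSingleton_apply_mk, one_smul]
    simp only [t, LinearMap.comp_apply, LinearEquiv.coe_coe, this]
    rfl
  obtain ⟨f, hf⟩ := hE.module_injective.out (R ∙ x).subtype (Submodule.subtype_injective _)
    (injectiveEnvelopeMap R (R ⧸ Ring.jacobson R) ∘ₗ σ ∘ₗ t)
  refine ⟨f, ?_⟩
  have := hf ⟨x, Submodule.mem_span_singleton_self x⟩
  rw [Submodule.subtype_apply] at this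
  rw [this, LinearMap.comp_apply, LinearMap.comp_apply, ht,
    map_ne_zero_iff _ hE.injective, map_ne_zero_iff _ hσ', map_one]
  have := Ideal.Quotient.nontrivial_iff.2 hp.ne_top
  exact one_ne_zero

end InjectiveEnvelope

/-! ### The dual of the regular module as an injective cogenerator -/

section Dual

variable (R Λ : Type u) [CommRing R] [Ring Λ] [Algebra R Λ]

variable {R Λ} in
/-- An element of `𝔻(Λᵒᵖ)` as an `R`-linear functional. -/
noncomputable def DualOp.toLinearMap (f : DualOp R Λ) : Λ →ₗ[R] injectiveEnvelope R (R ⧸ Ring.jacobson R) := f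

theorem DualOp.smul_apply (a : Λ) (f : DualOp R Λ) (x : Λ) :
    (a • f).toLinearMap x = f.toLinearMap (x * a) := rfl

/-- Maps of `Λ`-modules into `𝔻(Λᵒᵖ)` from `R`-linear functionals. -/
noncomputable def DualOp.lift {X : Type u} [AddCommGroup X] [Module Λ X] [Module R X] [IsScalarTower R Λ X]
    (h : X →ₗ[R] injectiveEnvelope R (R ⧸ Ring.jacobson R)) : X →ₗ[Λ] DualOp R Λ where
  toFun x := h ∘ₗ (LinearMap.toSpanSingleton Λ X x).restrictScalars R
  map_add' x y := LinearMap.ext fun a => by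
    change h (a • (x + y)) = h (a • x) + h (a • y)
    rw [smul_add, map_add]
  map_smul' b x := LinearMap.ext fun a => by
    change h (a • b • x) = h ((a * b) • x)
    rw [mul_smul]

/-- Evaluation at `1` of a map into `𝔻(Λᵒᵖ)`. -/
noncomputable def DualOp.eval {X : Type u} [AddCommGroup X] [Module Λ X] [Module R X] [IsScalarTower R Λ X]
    (g : X →ₗ[Λ] DualOp R Λ) : X →ₗ[R] injectiveEnvelope R (R ⧸ Ring.jacobson R) where
  toFun x := (g x).toLinearMap 1
  map_add' x y := by rw [map_add]; rfl
  map_smul' r x := by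
    have h : (g (r • x)).toLinearMap 1 = (g x).toLinearMap (r • 1) := by
      rw [← algebraMap_smul Λ r x, map_smul, DualOp.smul_apply, one_mul, Algebra.algebraMap_eq_smul_one]
    rw [h]
    exact (g x).toLinearMap.map_smul r 1

/-- By adjunction, Λ-maps into the dual are R-linear functionals, so extending them reduces to
injectivity of E over R. -/
instance DualOp.injective : Module.Injective Λ (DualOp R Λ) where
  out X Y _ _ _ _ f hf g := by
    let _ : Module R X := Module.compHom X (algebraMap R Λ)
    let _ : Module R Y := Module.compHom Y (algebraMap R Λ)
    have : IsScalarTower R Λ X := IsScalarTower.of_compHom R Λ X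
    have : IsScalarTower R Λ Y := IsScalarTower.of_compHom R Λ Y
    obtain ⟨h, hh⟩ := (injectiveEnvelopeMap_spec R (R ⧸ Ring.jacobson R)).module_injective.out
      (f.restrictScalars R) hf (DualOp.eval R Λ g)
    refine ⟨DualOp.lift R Λ h, fun x => LinearMap.ext fun a => ?_⟩
    change h (a • f x) = (g x).toLinearMap a
    rw [← map_smul]
    refine (hh (a • x)).trans ?_
    change (g (a • x)).toLinearMap 1 = _
    rw [map_smul, DualOp.smul_apply, one_mul]

instance DualOp.finite [IsArtinianRing R] [Module.Finite R Λ] :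
    Module.Finite Λ (DualOp R Λ) := by
  obtain ⟨S, hS⟩ := (finite_hom_injectiveEnvelope R Λ).fg_top
  have key : ∀ f : Λ →ₗ[R] injectiveEnvelope R (R ⧸ Ring.jacobson R),
      f ∈ Submodule.span R (S : Set (Λ →ₗ[R] injectiveEnvelope R (R ⧸ Ring.jacobson R))) →
      (show DualOp R Λ from f) ∈ Submodule.span Λ 
        (show Set (DualOp R Λ) from (S : Set (Λ →ₗ[R] injectiveEnvelope R (R ⧸ Ring.jacobson R)))) := by
    intro f hf
    induction hf using Submodule.span_induction with
    | mem x hx => exact Submodule.subset_span hx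
    | zero => exact Submodule.zero_mem _
    | add x y _ _ hx hy => exact Submodule.add_mem _ hx hy
    | smul r x _ hx =>
      -- Scalars from R are central in Λ, so R-generators also generate over Λ.
      have : (show DualOp R Λ from r • x) = algebraMap R Λ r • (show DualOp R Λ from x) := by
        refine LinearMap.ext fun a => ?_
        change r • x a = x (a * algebraMap R Λ r)
        rw [← Algebra.commutes, ← Algebra.smul_def, map_smul]
      rw [this]
      exact Submodule.smul_mem _ _ hx
  exact ⟨⟨S, eq_top_iff.2 fun f _ => key f (hS ▸ Submodule.mem_top)⟩⟩

theorem exists_hom_dualOp_ne_zero [IsArtinianRing R] {X : Type u} [AddCommGroup X] [Module Λ X]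
    {x : X} (hx : x ≠ 0) : ∃ f : X →ₗ[Λ] DualOp R Λ, f x ≠ 0 := by
  let _ : Module R X := Module.compHom X (algebraMap R Λ)
  have : IsScalarTower R Λ X := IsScalarTower.of_compHom R Λ X
  obtain ⟨h, hh⟩ := exists_hom_injectiveEnvelope_ne_zero R hx
  refine ⟨DualOp.lift R Λ h, fun h0 => hh ?_⟩
  have : h ((1 : Λ) • x) = 0 := LinearMap.congr_fun h0 1
  rwa [one_smul] at this

/-- The group of homomorphisms between finitely generated modules is generated over the center
by finitely many elements. -/
theorem exists_generators_hom [IsArtinianRing R] [Module.Finite R Λ] {X Y : ModuleCat.{u} Λ}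
    (hX : ModuleCat.isFG Λ X) (hY : ModuleCat.isFG Λ Y) :
    ∃ (n : ℕ) (f : Fin n → (X ⟶ Y)), ∀ g : X ⟶ Y,
      (∃ c : Fin n → (X ⟶ X), g = ∑ i, c i ≫ f i) ∧ ∃ c : Fin n → (Y ⟶ Y), g = ∑ i, f i ≫ c i := by
  have : Module.Finite Λ X := hX
  have : Module.Finite Λ Y := hY
  let _ : Module R X := Module.compHom X (algebraMap R Λ)
  let _ : Module R Y := Module.compHom Y (algebraMap R Λ)
  have : IsScalarTower R Λ X := IsScalarTower.of_compHom R Λ X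
  have : IsScalarTower R Λ Y := IsScalarTower.of_compHom R Λ Y
  have : SMulCommClass Λ R X := IsScalarTower.to_smulCommClass'
  have : SMulCommClass Λ R Y := IsScalarTower.to_smulCommClass'
  have : Module.Finite R X := Module.Finite.trans Λ X
  have : Module.Finite R Y := Module.Finite.trans Λ Y
  -- Λ-linear maps form a submodule of the finitely generated module of R-linear maps, and R is
  -- Noetherian.
  have : Module.Finite R (X →ₗ[Λ] Y) := by
    let ρ : (X →ₗ[Λ] Y) →ₗ[R] (X →ₗ[R] Y) :=
      { toFun := fun f => f.restrictScalars R
        map_add' := fun _ _ => rfl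
        map_smul' := fun _ _ => rfl }
    exact Module.Finite.of_injective ρ (LinearMap.restrictScalars_injective R)
  obtain ⟨n, s, hs⟩ := Module.Finite.exists_fin (R := R) (M := X →ₗ[Λ] Y)
  refine ⟨n, fun i => ModuleCat.ofHom (s i), fun g => ?_⟩
  have hg : g.hom ∈ Submodule.span R (Set.range s) := hs ▸ Submodule.mem_top
  obtain ⟨r, hr⟩ := (Submodule.mem_span_range_iff_exists_fun R).1 hg
  constructor
  · refine ⟨fun i => ModuleCat.ofHom (r i • LinearMap.id), ?_⟩
    refine ModuleCat.hom_ext ?_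
    rw [← hr, ModuleCat.hom_sum]
    refine Finset.sum_congr rfl fun i _ => ?_
    ext x
    simp
  · refine ⟨fun i => ModuleCat.ofHom (r i • LinearMap.id), ?_⟩
    refine ModuleCat.hom_ext ?_
    rw [← hr, ModuleCat.hom_sum]
    refine Finset.sum_congr rfl fun i _ => ?_
    ext x
    simp

end Dual

/-! ### Projectivity criteria and reduced grade two -/

section Projective

variable {Λ : Type u} [Ring Λ]

local notation "ᴸΛ" => ModuleCat.of Λ Λ

instance projective_regular : Projective ᴸΛ :=
  ModuleCat.projective_of_free (Module.Basis.singleton Unit Λ)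

theorem isFG_regular : ModuleCat.isFG Λ ᴸΛ := Module.Finite.self Λ

theorem exists_epi_of_isFG {X : ModuleCat.{u} Λ} (hX : ModuleCat.isFG Λ X) :
    ∃ (P : ModuleCat.{u} Λ) (f : P ⟶ X), Epi f ∧ IsAddRetract ᴸΛ P := by
  have : Module.Finite Λ X := hX
  obtain ⟨n, f, hf⟩ := Module.Finite.exists_fin' Λ X
  exact ⟨ModuleCat.of Λ (Fin n → Λ), ModuleCat.ofHom f, (ModuleCat.epi_iff_surjective _).2 hf,
    isAddRetract_finPi ᴸΛ n⟩

theorem isAddRetract_regular_of_projective {X : ModuleCat.{u} Λ} (hX : ModuleCat.isFG Λ X)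
    [Projective X] : IsAddRetract ᴸΛ X := by
  obtain ⟨P, f, hf, hP⟩ := exists_epi_of_isFG hX
  exact hP.trans (.of_retract ⟨Projective.factorThru (𝟙 X) f, f, by simp⟩)

theorem shortExact_kernel {X P : ModuleCat.{u} Λ} (f : P ⟶ X) [Epi f] :
    (ShortComplex.mk _ _ (kernel.condition f)).ShortExact where
  exact := ShortComplex.exact_kernel f

theorem shortExact_cokernel {X I : ModuleCat.{u} Λ} (f : X ⟶ I) [Mono f] :
    (ShortComplex.mk _ _ (cokernel.condition f)).ShortExact where
  exact := ShortComplex.exact_cokernel f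

variable [IsNoetherianRing Λ]

/-- The syzygy is finitely generated projective, so it lies in add Λ; vanishing of Ext¹ into Λ
therefore splits the presentation. -/
theorem projective_of_hasProjectiveDimensionLT_two {X : ModuleCat.{u} Λ}
    (hX : ModuleCat.isFG Λ X) [HasProjectiveDimensionLT X 2]
    (h : Subsingleton (Ext X ᴸΛ 1)) : Projective X := by
  obtain ⟨P, f, hf, hP⟩ := exists_epi_of_isFG hX
  have hPp : Projective P := hP.projective inferInstance
  have hS := shortExact_kernel f
  have hK : Projective (kernel f) := by
    rw [projective_iff_hasProjectiveDimensionLT_one]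
    exact hS.hasProjectiveDimensionLT_X₁ 1 (inferInstanceAs (HasProjectiveDimensionLT P 1)) ‹_›
  have hK' := isAddRetract_regular_of_projective (Mono.isFG (kernel.ι f) (hP.isFG isFG_regular))
  obtain ⟨s⟩ := hS.nonempty_splitting (hK'.subsingleton_ext_right h)
  exact (IsAddRetract.of_retract s.retractRight).projective hPp

/-- Dimension shifting turns Ext²(X, Λ) = 0 into Ext¹(K, Λ) = 0 for the syzygy K. So K is
projective, pd X ≤ 1, and the previous criterion applies to X itself. -/
theorem projective_of_hasProjectiveDimensionLT_three {X : ModuleCat.{u} Λ}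
    (hX : ModuleCat.isFG Λ X) [HasProjectiveDimensionLT X 3]
    (h₁ : Subsingleton (Ext X ᴸΛ 1)) (h₂ : Subsingleton (Ext X ᴸΛ 2)) : Projective X := by
  obtain ⟨P, f, hf, hP⟩ := exists_epi_of_isFG hX
  have hPp : Projective P := hP.projective inferInstance
  have hS := shortExact_kernel f
  have hK : HasProjectiveDimensionLT (kernel f) 2 :=
    hS.hasProjectiveDimensionLT_X₁ 2 (inferInstanceAs (HasProjectiveDimensionLT P 2)) ‹_›
  have hext : Subsingleton (Ext (kernel f) ᴸΛ 1) := by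
    refine subsingleton_of_forall_eq 0 fun x => ?_
    obtain ⟨y, rfl⟩ := Ext.contravariant_sequence_exact₁ hS _ x (n₁ := 2) rfl
      (Subsingleton.elim (α := Ext X ᴸΛ 2) _ _)
    rw [Ext.eq_zero_of_projective y, Ext.comp_zero]
  have hKp := projective_of_hasProjectiveDimensionLT_two
    (Mono.isFG (kernel.ι f) (hP.isFG isFG_regular)) hext
  have : HasProjectiveDimensionLT X 2 :=
    hS.hasProjectiveDimensionLT_X₃ 1 (inferInstanceAs (HasProjectiveDimensionLT (kernel f) 1))
      (inferInstanceAs (HasProjectiveDimensionLT P 2))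
  exact projective_of_hasProjectiveDimensionLT_two hX h₁

omit [IsNoetherianRing Λ] in
theorem reducedGrade_eq_two_iff {M : ModuleCat.{u} Λ} :
    reducedGrade M = 2 ↔ Subsingleton (Ext M ᴸΛ 1) ∧ Nontrivial (Ext M ᴸΛ 2) := by
  have hle : ∀ n : ℕ, 1 ≤ n → Nontrivial (Ext M ᴸΛ n) → reducedGrade M ≤ n :=
    fun n h₁ h₂ => biInf_le (fun n : ℕ => (n : ℕ∞)) (show n ∈ {n : ℕ | _} from ⟨h₁, h₂⟩)
  constructor
  · intro h
    have h₁ : Subsingleton (Ext M ᴸΛ 1) := by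
      by_contra h₁
      have := hle 1 le_rfl (not_subsingleton_iff_nontrivial.1 h₁)
      rw [h] at this
      exact absurd this (by decide)
    refine ⟨h₁, ?_⟩
    by_contra h₂
    have : (3 : ℕ∞) ≤ reducedGrade M := by
      refine le_iInf₂ fun n hn => ?_
      have h1 : n ≠ 1 := by
        rintro rfl
        exact not_subsingleton_iff_nontrivial.2 hn.2 h₁
      have h2 : n ≠ 2 := by
        rintro rfl
        exact h₂ hn.2
      have := hn.1
      exact_mod_cast (by lia : 3 ≤ n)
    rw [h] at this
    exact absurd this (by decide)
  · rintro ⟨h₁, h₂⟩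
    refine le_antisymm (hle 2 (by lia) h₂) (le_iInf₂ fun n hn => ?_)
    have h1 : n ≠ 1 := by
      rintro rfl
      exact not_subsingleton_iff_nontrivial.2 hn.2 h₁
    have := hn.1
    exact_mod_cast (by lia : 2 ≤ n)

theorem reducedGrade_eq_two {M : ModuleCat.{u} Λ} (hM : ModuleCat.isFG Λ M)
    [HasProjectiveDimensionLT M 3] (hp : ¬ Projective M) (h : Subsingleton (Ext M ᴸΛ 1)) :
    reducedGrade M = 2 := by
  refine reducedGrade_eq_two_iff.2 ⟨h, ?_⟩
  by_contra h₂
  exact hp (projective_of_hasProjectiveDimensionLT_three hM h (not_nontrivial_iff_subsingleton.1 h₂))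

end Projective

/-! ### Approximations by add T and injectivity criteria -/

section Approximation

variable (R : Type u) {Λ : Type u} [CommRing R] [Ring Λ] [Algebra R Λ] [IsArtinianRing R]

local notation "DΛ" => ModuleCat.of Λ (DualOp R Λ)

omit [IsArtinianRing R] in
instance injective_dualOp : Injective DΛ := Module.injective_object_of_injective_module Λ _

theorem IsLeftApproximation.mono {C : ObjectProperty (ModuleCat.{u} Λ)} {X Y : ModuleCat.{u} Λ}
    {f : X ⟶ Y} (hf : IsLeftApproximation C f) (hC : C DΛ) : Mono f := by
  rw [ModuleCat.mono_iff_injective, injective_iff_map_eq_zero]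
  intro x hx
  by_contra hx0
  obtain ⟨g, hg⟩ := exists_hom_dualOp_ne_zero R Λ hx0
  obtain ⟨h, hh⟩ := hf.2 _ hC (ModuleCat.ofHom g)
  apply hg
  change (ModuleCat.ofHom g).hom x = 0
  rw [← hh, ModuleCat.hom_comp, LinearMap.comp_apply, hx, map_zero]

variable [Module.Finite R Λ]

-- The approximation is the map X → Tⁿ whose components generate Hom(X, T) over End(T).
include R in
theorem exists_leftApproximation {T X : ModuleCat.{u} Λ} (hT : ModuleCat.isFG Λ T)
    (hX : ModuleCat.isFG Λ X) :
    ∃ (Y : ModuleCat.{u} Λ) (f : X ⟶ Y), IsLeftApproximation (addClosure T) f := by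
  obtain ⟨n, f, hf⟩ := exists_generators_hom R Λ hX hT
  refine ⟨ModuleCat.of Λ (Fin n → T), ModuleCat.ofHom (LinearMap.pi fun i => (f i).hom),
    addClosure_iff.2 (isAddRetract_finPi T n), fun Z hZ g => ?_⟩
  obtain ⟨m, p, q, hpq⟩ := addClosure_iff.1 hZ
  choose c hc using fun j => (hf (g ≫ p j)).2
  refine ⟨∑ j, (∑ i, ModuleCat.ofHom (LinearMap.proj i) ≫ c j i) ≫ q j, ?_⟩
  rw [Preadditive.comp_sum, ← Category.comp_id g, ← hpq, Preadditive.comp_sum]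
  refine Finset.sum_congr rfl fun j _ => ?_
  rw [← Category.assoc, ← Category.assoc, hc, Preadditive.comp_sum]
  rfl

include R in
theorem exists_rightApproximation {T X : ModuleCat.{u} Λ} (hT : ModuleCat.isFG Λ T)
    (hX : ModuleCat.isFG Λ X) :
    ∃ (Y : ModuleCat.{u} Λ) (f : Y ⟶ X), IsRightApproximation (addClosure T) f := by
  obtain ⟨n, f, hf⟩ := exists_generators_hom R Λ hT hX
  refine ⟨ModuleCat.of Λ (Fin n → T), ∑ i, ModuleCat.ofHom (LinearMap.proj i) ≫ f i,
    addClosure_iff.2 (isAddRetract_finPi T n), fun Z hZ g => ?_⟩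
  obtain ⟨m, p, q, hpq⟩ := addClosure_iff.1 hZ
  choose c hc using fun j => (hf (q j ≫ g)).1
  refine ⟨∑ j, p j ≫ ModuleCat.ofHom (LinearMap.pi fun i => (c j i).hom), ?_⟩
  rw [Preadditive.sum_comp, ← Category.id_comp g, ← hpq, Preadditive.sum_comp]
  refine Finset.sum_congr rfl fun j _ => ?_
  rw [Category.assoc, Category.assoc, hc, Preadditive.comp_sum]
  rfl

theorem isFG_dualOp : ModuleCat.isFG Λ DΛ := DualOp.finite R Λ

theorem exists_mono_of_isFG {X : ModuleCat.{u} Λ} (hX : ModuleCat.isFG Λ X) :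
    ∃ (I : ModuleCat.{u} Λ) (f : X ⟶ I), Mono f ∧ IsAddRetract DΛ I := by
  obtain ⟨I, f, hf⟩ := exists_leftApproximation R (isFG_dualOp R) hX
  exact ⟨I, f, hf.mono R (addClosure_iff.2 (.refl _)), addClosure_iff.1 hf.1⟩

theorem isAddRetract_dualOp_of_injective {X : ModuleCat.{u} Λ} (hX : ModuleCat.isFG Λ X)
    [Injective X] : IsAddRetract DΛ X := by
  obtain ⟨I, f, hf, hI⟩ := exists_mono_of_isFG R hX
  exact hI.trans (.of_retract ⟨f, Injective.factorThru (𝟙 X) f, by simp⟩)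

/-- The cosyzygy is finitely generated injective, so it is a summand of copies of the dual, and the
hypothesis splits the copresentation. -/
theorem injective_of_hasInjectiveDimensionLT_two {X : ModuleCat.{u} Λ}
    (hX : ModuleCat.isFG Λ X) [HasInjectiveDimensionLT X 2]
    (h : Subsingleton (Ext DΛ X 1)) : Injective X := by
  obtain ⟨I, f, hf, hI⟩ := exists_mono_of_isFG R hX
  have hIi : Injective I := hI.injective inferInstance
  have hS := shortExact_cokernel f
  have hK : Injective (cokernel f) := by
    rw [injective_iff_hasInjectiveDimensionLT_one]
    exact hS.hasInjectiveDimensionLT_X₃ 1 (inferInstanceAs (HasInjectiveDimensionLT I 1)) ‹_›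
  have hK' := isAddRetract_dualOp_of_injective R
    (Epi.isFG (cokernel.π f) (hI.isFG (isFG_dualOp R)))
  obtain ⟨s⟩ := hS.nonempty_splitting (hK'.subsingleton_ext_left h)
  exact (IsAddRetract.of_retract s.retractLeft).injective hIi

end Approximation

/-! ### Global dimension -/

section GlobalDimension

variable {Λ : Type u} [Ring Λ]

theorem hasProjectiveDimensionLT_three_of_globalDimension_le (h : globalDimension Λ ≤ 2)
    (M : ModuleCat.{u} Λ) : HasProjectiveDimensionLT M 3 :=
  (projectiveDimension_le_iff M 2).1 ((le_iSup _ M).trans h)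

theorem hasInjectiveDimensionLT_three_of_globalDimension_le (h : globalDimension Λ ≤ 2)
    (M : ModuleCat.{u} Λ) : HasInjectiveDimensionLT M 3 := by
  rw [hasInjectiveDimensionLT_iff]
  intro i hi Y e
  have := hasProjectiveDimensionLT_three_of_globalDimension_le h Y
  exact Ext.eq_zero_of_hasProjectiveDimensionLT e 3 hi

/-- Projectivity of each Λ/I splits off every left ideal I, so Λ is semisimple. -/
theorem globalDimension_le_zero_of_projective
    (h : ∀ X : ModuleCat.{u} Λ, ModuleCat.isFG Λ X → Projective X) : globalDimension Λ ≤ 0 := by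
  have hss : IsSemisimpleRing Λ := by
    refine (isSemisimpleModule_iff Λ Λ).2 ⟨fun I => ?_⟩
    have : Projective (ModuleCat.of Λ (Λ ⧸ I)) := h _ (Module.Finite.quotient Λ I)
    have : Module.Projective Λ (Λ ⧸ I) := (IsProjective.iff_projective _).2 this
    obtain ⟨s, hs⟩ := Module.projective_lifting_property I.mkQ LinearMap.id I.mkQ_surjective
    let f : Λ →ₗ[Λ] I := LinearMap.codRestrict I (LinearMap.id - s ∘ₗ I.mkQ) fun x => by
      rw [← Submodule.Quotient.mk_eq_zero, ← Submodule.mkQ_apply, LinearMap.sub_apply, map_sub,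
        sub_eq_zero]
      exact (LinearMap.congr_fun hs (I.mkQ x)).symm
    refine ⟨LinearMap.ker f, LinearMap.isCompl_of_proj fun x => Subtype.ext ?_⟩
    have : I.mkQ (x : Λ) = 0 := (Submodule.Quotient.mk_eq_zero I).2 x.2
    simp only [f, LinearMap.codRestrict_apply, LinearMap.sub_apply, LinearMap.comp_apply, this,
      map_zero, sub_zero, LinearMap.id_apply]
  refine iSup_le fun M => ?_
  have : Projective M := (IsProjective.iff_projective _).1 (Module.projective_of_isSemisimpleRing Λ M)
  exact (projectiveDimension_le_iff M 0).2 ((projective_iff_hasProjectiveDimensionLE_zero M).1 this)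

variable (R : Type u) [CommRing R] [Algebra R Λ] [IsArtinianRing R] [Module.Finite R Λ]

local notation "ᴸΛ" => ModuleCat.of Λ Λ
local notation "DΛ" => ModuleCat.of Λ (DualOp R Λ)

include R in
theorem isNoetherianRing_of_finite_artinian : IsNoetherianRing Λ :=
  IsNoetherianRing.of_finite R Λ

include R in
theorem isArtinianRing_of_finite_artinian : IsArtinianRing Λ :=
  IsArtinianRing.of_finite R Λ

/-- If D is projective, Ext¹(D, -) = 0. The cosyzygy of X has injective dimension at most 1, so it
is injective; then so is X. Thus X lies in add D and is projective. -/
theorem globalDimension_le_zero_of_projective_dualOp (h : globalDimension Λ ≤ 2)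
    (hD : Projective DΛ) : globalDimension Λ ≤ 0 := by
  have hext : ∀ X : ModuleCat.{u} Λ, Subsingleton (Ext DΛ X 1) := fun X =>
    projective_iff_subsingleton_ext_one.1 hD (Y := _)
  refine globalDimension_le_zero_of_projective fun X hX => ?_
  obtain ⟨I, f, hf, hI⟩ := exists_mono_of_isFG R hX
  have hIi : Injective I := hI.injective inferInstance
  have hS := shortExact_cokernel f
  have hId := hasInjectiveDimensionLT_three_of_globalDimension_le h X
  have : HasInjectiveDimensionLT (cokernel f) 2 :=
    hS.hasInjectiveDimensionLT_X₃ 2 (inferInstanceAs (HasInjectiveDimensionLT I 2)) hId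
  have : Injective (cokernel f) := injective_of_hasInjectiveDimensionLT_two R
    (Epi.isFG (cokernel.π f) (hI.isFG (isFG_dualOp R))) (hext _)
  have : HasInjectiveDimensionLT X 2 :=
    hS.hasInjectiveDimensionLT_X₁ 1 (inferInstanceAs (HasInjectiveDimensionLT (cokernel f) 1))
      (inferInstanceAs (HasInjectiveDimensionLT I 2))
  have : Injective X := injective_of_hasInjectiveDimensionLT_two R hX (hext _)
  exact (isAddRetract_dualOp_of_injective R hX).projective hD

end GlobalDimension

/-! ### Maximal 1-orthogonal subcategories -/

section MaximalOrthogonal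

variable {Λ : Type u} [Ring Λ]

local notation "ᴸΛ" => ModuleCat.of Λ Λ

namespace IsMaximalOrthogonal

variable {C : ObjectProperty (ModuleCat.{u} Λ)} (hC : IsMaximalOrthogonal 1 C (ModuleCat.isFG Λ))
include hC

theorem mem_iff_left {X : ModuleCat.{u} Λ} :
    C X ↔ ModuleCat.isFG Λ X ∧ ∀ Y, C Y → Subsingleton (Ext X Y 1) := by
  constructor
  · intro h
    refine ⟨hC.le _ h, fun Y hY => ?_⟩
    rw [hC.eq_left] at h
    exact h.1.2 Y hY 1 le_rfl le_rfl
  · rintro ⟨h₁, h₂⟩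
    rw [hC.eq_left]
    refine ⟨⟨h₁, fun Y hY i hi hi' => ?_⟩, h₁⟩
    obtain rfl : i = 1 := le_antisymm hi' hi
    exact h₂ Y hY

theorem mem_iff_right {X : ModuleCat.{u} Λ} :
    C X ↔ ModuleCat.isFG Λ X ∧ ∀ Y, C Y → Subsingleton (Ext Y X 1) := by
  constructor
  · intro h
    refine ⟨hC.le _ h, fun Y hY => ?_⟩
    rw [hC.eq_right] at h
    exact h.1.2 Y hY 1 le_rfl le_rfl
  · rintro ⟨h₁, h₂⟩
    rw [hC.eq_right]
    refine ⟨⟨h₁, fun Y hY i hi hi' => ?_⟩, h₁⟩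
    obtain rfl : i = 1 := le_antisymm hi' hi
    exact h₂ Y hY

theorem mem_of_isAddRetract {X Y : ModuleCat.{u} Λ} (h : IsAddRetract X Y) (hX : C X) : C Y := by
  rw [hC.mem_iff_left] at hX ⊢
  exact ⟨h.isFG hX.1, fun Z hZ => h.subsingleton_ext_left (hX.2 Z hZ)⟩

theorem mem_of_projective {X : ModuleCat.{u} Λ} (hX : ModuleCat.isFG Λ X) [Projective X] : C X :=
  hC.mem_iff_left.2 ⟨hX, fun _ _ => projective_iff_subsingleton_ext_one.1 ‹_› (Y := _)⟩

theorem mem_of_injective {X : ModuleCat.{u} Λ} (hX : ModuleCat.isFG Λ X) [Injective X] : C X :=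
  hC.mem_iff_right.2 ⟨hX, fun _ _ => injective_iff_subsingleton_ext_one.1 ‹_› (Y := _)⟩

end IsMaximalOrthogonal

variable (R : Type u) [CommRing R] [Algebra R Λ] [IsArtinianRing R] [Module.Finite R Λ]

local notation "DΛ" => ModuleCat.of Λ (DualOp R Λ)
local notation "TΛ" => ModuleCat.of Λ (Λ × DualOp R Λ)

include R in
theorem IsMaximalOrthogonal.projective_or_injective {C : ObjectProperty (ModuleCat.{u} Λ)}
    (hC : IsMaximalOrthogonal 1 C (ModuleCat.isFG Λ)) (hΛ : IsAlmostHereditary Λ)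
    {X : ModuleCat.{u} Λ} (hX : C X) (hi : Indecomposable X) : Projective X ∨ Injective X := by
  have := isNoetherianRing_of_finite_artinian R (Λ := Λ)
  have hfg := hC.le _ hX
  rcases hΛ.dimension_le X hfg hi with h | h
  · right
    have : HasInjectiveDimensionLT X 2 := (injectiveDimension_le_iff X 1).1 h
    exact injective_of_hasInjectiveDimensionLT_two R hfg
      ((hC.mem_iff_right.1 hX).2 _ (hC.mem_of_injective (isFG_dualOp R)))
  · left
    have : HasProjectiveDimensionLT X 2 := (projectiveDimension_le_iff X 1).1 h
    exact projective_of_hasProjectiveDimensionLT_two hfg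
      ((hC.mem_iff_left.1 hX).2 _ (hC.mem_of_projective isFG_regular))

omit [IsArtinianRing R] [Module.Finite R Λ] in
theorem isAddRetract_prod_regular : IsAddRetract TΛ ᴸΛ :=
  .of_retract ⟨ModuleCat.ofHom (LinearMap.inl Λ Λ (DualOp R Λ)),
    ModuleCat.ofHom (LinearMap.fst Λ Λ (DualOp R Λ)), rfl⟩

omit [IsArtinianRing R] [Module.Finite R Λ] in
theorem isAddRetract_prod_dualOp : IsAddRetract TΛ DΛ :=
  .of_retract ⟨ModuleCat.ofHom (LinearMap.inr Λ Λ (DualOp R Λ)),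
    ModuleCat.ofHom (LinearMap.snd Λ Λ (DualOp R Λ)), rfl⟩

theorem isFG_prod : ModuleCat.isFG Λ TΛ := Module.Finite.prod

omit [IsArtinianRing R] [Module.Finite R Λ] in
theorem isAddRetract_biprod_prod : IsAddRetract (ᴸΛ ⊞ DΛ) TΛ :=
  .of_retract (Retract.ofIso (ModuleCat.biprodIsoProd ᴸΛ DΛ).symm)

include R in
/-- If all indecomposable modules with `Q` are summands of copies of `T`, so are all modules
with `Q`. -/
theorem isAddRetract_of_indecomposable {T : ModuleCat.{u} Λ} (Q : ModuleCat.{u} Λ → Prop)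
    (hQ : ∀ X Y, Retract X Y → Q Y → Q X)
    (hT : ∀ X, ModuleCat.isFG Λ X → Indecomposable X → Q X → IsAddRetract T X)
    {X : ModuleCat.{u} Λ} (hX : ModuleCat.isFG Λ X) (hQX : Q X) : IsAddRetract T X := by
  have := isArtinianRing_of_finite_artinian R (Λ := Λ)
  exact isFG_induction_indecomposable (IsAddRetract T) Q hQ (fun _ => .of_isZero)
    (fun _ _ _ e h₁ h₂ => (h₁.biprod h₂).trans (.of_retract (Retract.ofIso e))) hT X hX hQX

theorem IsMaximalOrthogonal.eq_addClosure {C : ObjectProperty (ModuleCat.{u} Λ)}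
    (hC : IsMaximalOrthogonal 1 C (ModuleCat.isFG Λ)) (hΛ : IsAlmostHereditary Λ) :
    C = addClosure TΛ := by
  ext X
  rw [addClosure_iff]
  constructor
  · intro hX
    refine isAddRetract_of_indecomposable R C
      (fun X Y r => hC.mem_of_isAddRetract (.of_retract r)) (fun Y hY hi hCY => ?_) (hC.le _ hX) hX
    rcases hC.projective_or_injective R hΛ hCY hi with h | h
    · exact (isAddRetract_prod_regular R).trans (isAddRetract_regular_of_projective hY)
    · exact (isAddRetract_prod_dualOp R).trans (isAddRetract_dualOp_of_injective R hY)
  · intro hX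
    refine hC.mem_of_isAddRetract hX (hC.mem_iff_left.2 ⟨isFG_prod R, fun Y hY => ?_⟩)
    refine (isAddRetract_biprod_prod R).subsingleton_ext_left ?_
    have h₁ := (hC.mem_iff_left.1 (hC.mem_of_projective isFG_regular)).2 Y hY
    have h₂ := (hC.mem_iff_left.1 (hC.mem_of_injective (isFG_dualOp R))).2 Y hY
    exact Ext.biprodAddEquiv.toEquiv.subsingleton

/-- If every non-projective indecomposable module is injective precisely when its reduced grade
is two, then `add (Λ ⊕ 𝔻Λᵒᵖ)` is maximal orthogonal. -/
theorem isMaximalOrthogonal_addClosure (hgl : globalDimension Λ ≤ 2)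
    (h : ∀ M : ModuleCat.{u} Λ, ModuleCat.isFG Λ M → Indecomposable M → ¬ Projective M →
      (Injective M ↔ reducedGrade M = 2)) :
    IsMaximalOrthogonal 1 (addClosure TΛ) (ModuleCat.isFG Λ) := by
  have := isNoetherianRing_of_finite_artinian R (Λ := Λ)
  have hart := isArtinianRing_of_finite_artinian R (Λ := Λ)
  have hpd := hasProjectiveDimensionLT_three_of_globalDimension_le hgl
  -- The hypothesis only concerns indecomposables, so the vanishing is proved for all finitely
  -- generated injectives by decomposing them.
  have hDΛ : Subsingleton (Ext DΛ ᴸΛ 1) := by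
    refine isFG_induction_indecomposable (fun X => Subsingleton (Ext X ᴸΛ 1)) Injective
      (fun X Y r _ => r.injective) (fun X hX => ?_) (fun X Y Z e _ _ => ?_)
      (fun X hX hi hinj => ?_) DΛ (isFG_dualOp R) inferInstance
    · exact (IsAddRetract.of_isZero (T := ᴸΛ) hX).subsingleton_ext_left
        (projective_iff_subsingleton_ext_one.1 inferInstance (Y := _))
    · exact (IsAddRetract.of_retract (Retract.ofIso e)).subsingleton_ext_left
        Ext.biprodAddEquiv.toEquiv.subsingleton
    · by_cases hp : Projective X
      · exact projective_iff_subsingleton_ext_one.1 hp (Y := _)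
      · exact (reducedGrade_eq_two_iff.1 ((h X hX hi hp).1 hinj)).1
  have hTT : Subsingleton (Ext TΛ TΛ 1) := by
    refine (isAddRetract_biprod_prod R).subsingleton_ext_left ?_
    have h₁ : Subsingleton (Ext ᴸΛ TΛ 1) :=
      projective_iff_subsingleton_ext_one.1 inferInstance (Y := _)
    have h₂ : Subsingleton (Ext DΛ TΛ 1) := by
      refine (isAddRetract_biprod_prod R).subsingleton_ext_right ?_
      have : Subsingleton (Ext DΛ DΛ 1) :=
        injective_iff_subsingleton_ext_one.1 inferInstance (Y := _)
      exact Ext.addEquivBiprod.toEquiv.subsingleton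
    exact Ext.biprodAddEquiv.toEquiv.subsingleton
  have hCC : ∀ X Y : ModuleCat.{u} Λ, addClosure TΛ X → addClosure TΛ Y →
      Subsingleton (Ext X Y 1) := fun X Y hX hY =>
    (addClosure_iff.1 hX).subsingleton_ext_left ((addClosure_iff.1 hY).subsingleton_ext_right hTT)
  have hfg : ∀ X : ModuleCat.{u} Λ, addClosure TΛ X → ModuleCat.isFG Λ X := fun X hX =>
    (addClosure_iff.1 hX).isFG (isFG_prod R)
  have hleft : ∀ X : ModuleCat.{u} Λ, ModuleCat.isFG Λ X → Subsingleton (Ext X ᴸΛ 1) →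
      addClosure TΛ X := by
    intro X hX hXΛ
    rw [addClosure_iff]
    refine isAddRetract_of_indecomposable R (fun X => Subsingleton (Ext X ᴸΛ 1))
      (fun X Y r => (IsAddRetract.of_retract r).subsingleton_ext_left) (fun Y hY hi hYΛ => ?_)
      hX hXΛ
    by_cases hp : Projective Y
    · exact (isAddRetract_prod_regular R).trans (isAddRetract_regular_of_projective hY)
    · have := (h Y hY hi hp).2 (reducedGrade_eq_two hY hp hYΛ)
      exact (isAddRetract_prod_dualOp R).trans (isAddRetract_dualOp_of_injective R hY)
  have hΛ : addClosure TΛ ᴸΛ := addClosure_iff.2 (isAddRetract_prod_regular R)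
  have hD : addClosure TΛ DΛ := addClosure_iff.2 (isAddRetract_prod_dualOp R)
  refine ⟨hfg, le_rfl, ⟨fun X hX => exists_leftApproximation R (isFG_prod R) hX,
    fun X hX => exists_rightApproximation R (isFG_prod R) hX⟩, ?_, ?_⟩
  · refine le_antisymm (fun X hX => ⟨⟨hfg X hX, fun Y hY i hi hi' => ?_⟩, hfg X hX⟩) fun X hX =>
      hleft X hX.2 (hX.1.2 _ hΛ 1 le_rfl le_rfl)
    obtain rfl : i = 1 := le_antisymm hi' hi
    exact hCC X Y hX hY
  · refine le_antisymm (fun X hX => ⟨⟨hfg X hX, fun Y hY i hi hi' => ?_⟩, hfg X hX⟩) fun X hX => ?_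
    -- X is exhibited as a summand of its approximation Y, by showing that the cokernel lies in the
    -- subcategory.
    · obtain ⟨Y, f, hf⟩ := exists_leftApproximation R (isFG_prod R) hX.2
      have hmono := hf.mono R hD
      have hS := shortExact_cokernel f
      have hK : addClosure TΛ (cokernel f) := by
        refine hleft _ (Epi.isFG (cokernel.π f) (hfg _ hf.1)) ?_
        refine subsingleton_of_forall_eq 0 fun x => ?_
        have h₀ : Subsingleton (Ext Y ᴸΛ 1) := hCC _ _ hf.1 hΛ
        -- The class x is the connecting image of some g : X → Λ. As g factors through the
        -- approximation, x contains the extension class followed by `f`, which is zero.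
        obtain ⟨y, rfl⟩ := Ext.contravariant_sequence_exact₃ hS _ x
          (Subsingleton.elim (α := Ext Y ᴸΛ 1) _ _) (n₀ := 0) rfl
        obtain ⟨g, rfl⟩ := (Ext.mk₀_bijective _ _).2 y
        obtain ⟨k, rfl⟩ := hf.2 _ hΛ g
        rw [← Ext.mk₀_comp_mk₀]
        exact hS.extClass_comp_assoc _
      obtain ⟨s⟩ := hS.nonempty_splitting (hX.1.2 _ hK 1 le_rfl le_rfl)
      exact addClosure_iff.2 ((addClosure_iff.1 hf.1).trans (.of_retract s.retractLeft))
    · obtain rfl : i = 1 := le_antisymm hi' hi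
      exact hCC Y X hY hX

end MaximalOrthogonal

/-! ### The equivalences -/

theorem theorem3p15 (R Λ : Type u) [CommRing R] [IsArtinianRing R] [Ring Λ] [Algebra R Λ]
    [Module.Finite R Λ] (hΛ : IsAlmostHereditary Λ) (hgl : globalDimension Λ = 2) :
    List.TFAE
      [∃ C : ObjectProperty (ModuleCat.{u} Λ), IsMaximalOrthogonal 1 C (ModuleCat.isFG Λ),
       reducedGrade (ModuleCat.of Λ (DualOp R Λ)) = 2 ∧
         ∀ M : ModuleCat.{u} Λ, ModuleCat.isFG Λ M → Indecomposable M → ¬ Projective M →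
           reducedGrade M = 2 → Injective M,
       ∀ M : ModuleCat.{u} Λ, ModuleCat.isFG Λ M → Indecomposable M → ¬ Projective M →
         (Injective M ↔ reducedGrade M = 2)] ∧
    ∀ C : ObjectProperty (ModuleCat.{u} Λ), IsMaximalOrthogonal 1 C (ModuleCat.isFG Λ) →
      C = addClosure (ModuleCat.of Λ (Λ × DualOp R Λ)) := by
  have := isNoetherianRing_of_finite_artinian R (Λ := Λ)
  have hpd := hasProjectiveDimensionLT_three_of_globalDimension_le hgl.le
  refine ⟨?_, fun C hC => hC.eq_addClosure R hΛ⟩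
  tfae_have 1 → 2 := by
    rintro ⟨C, hC⟩
    have hCΛ : C (ModuleCat.of Λ Λ) := hC.mem_of_projective isFG_regular
    have hCD := hC.mem_of_injective (isFG_dualOp R (Λ := Λ))
    constructor
    · refine reducedGrade_eq_two (isFG_dualOp R) (fun hp => ?_) ((hC.mem_iff_left.1 hCD).2 _ hCΛ)
      have := globalDimension_le_zero_of_projective_dualOp R hgl.le hp
      rw [hgl] at this
      exact absurd this (by decide)
    · intro M hM hi hp hr
      -- Since C = add(Λ ⊕ D) and Ext¹(M, D) = 0, membership only requires Ext¹(M, Λ) = 0, which the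
      -- grade provides.
      have hCM : C M := by
        refine hC.mem_iff_left.2 ⟨hM, fun Y hY => ?_⟩
        rw [hC.eq_addClosure R hΛ] at hY
        refine (addClosure_iff.1 hY).subsingleton_ext_right
          ((isAddRetract_biprod_prod R).subsingleton_ext_right ?_)
        have h₁ := (reducedGrade_eq_two_iff.1 hr).1
        have h₂ : Subsingleton (Ext M (ModuleCat.of Λ (DualOp R Λ)) 1) :=
          injective_iff_subsingleton_ext_one.1 inferInstance (Y := _)
        exact Ext.addEquivBiprod.toEquiv.subsingleton
      exact (hC.projective_or_injective R hΛ hCM hi).resolve_left hp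
  tfae_have 2 → 3 := by
    rintro ⟨h₁, h₂⟩ M hM hi hp
    refine ⟨fun _ => ?_, h₂ M hM hi hp⟩
    -- An injective M is a summand of copies of D, so it inherits Ext¹(D, Λ) = 0.
    exact reducedGrade_eq_two hM hp ((isAddRetract_dualOp_of_injective R hM).subsingleton_ext_left
      (reducedGrade_eq_two_iff.1 h₁).1)
  tfae_have 3 → 1 := fun h => ⟨_, isMaximalOrthogonal_addClosure R hgl.le h⟩
  tfae_finish
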